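/- Let $N$ be a finite set of agents, $M$ a finite set of indivisible goods, $C$ a finite set of divisible goods, $E=M\sqcup C$, and let $v_{ie}\in\{0,1\}$ be the value of good $e\in E$ for agent $i\in N$, where for every $e\in E$ some $i\in N$ has $v_{ie}=1$. An *allocation* is a matrix $\pi\in[0,1]^{N\times E}$ with $\sum_{i\in N}\pi_{ie}=1$ for all $e\in E$, with $\pi_{ie}=0$ whenever $v_{ie}=0$, and with $\pi_{ie}\in\{0,1\}$ for all $i\in N$ and $e\in M$; its utility vector is $\big(\sum_{e\in E}\pi_{ie}\big)_{i\in N}$. For $X\subseteq N$ let $f_M(X)=|\{g\in M: v_{ig}=0\ \forall i\notin X\}|$, $f_C(X)=|\{c\in C: v_{ic}=0\ \forall i\notin X\}|$ and $f_E=f_M+f_C$. For $f\colon 2^N\to\mathbb{Z}$ let $\bar{\mathbf B}(f)=\{x\in\mathbb{R}^N: \sum_{i\in N}x_i=f(N),\ \sum_{i\in X}x_i\ge f(X)\ \forall X\subseteq N\}$, and let $$\mathbf{B}_E=\{x+y : x\in\bar{\mathbf B}(f_M)\cap\mathbb{Z}^N,\ y\in\bar{\mathbf B}(f_C)\}.$$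 *Canonical partitions.* For $\beta\in\mathbb{Z}$ let $L(\beta)$ be the smallest (with respect to inclusion) maximizer of $X\mapsto f_E(X)-\beta|X|$ over $X\subseteq N$. Let $\beta_1>\beta_2>\dots>\beta_q$ be the finitely many integers $\beta$ with $L(\beta)\neq L(\beta-1)$, and let $N_j=L(\beta_j-1)\setminus L(\beta_j)$ for $j=1,\dots,q$. Define recursively, for $j=1,\dots,q$, $$M_j=\Big\{g\in M\setminus\bigcup_{j'<j}M_{j'} : v_{ig}=0\ \ \forall i\in N\setminus\bigcup_{j'\le j}N_{j'}\Big\},\qquad C_j=\Big\{c\in C\setminus\bigcup_{j'<j}C_{j'} : v_{ic}=0\ \ \forall i\in N\setminus\bigcup_{j'\le j}N_{j'}\Big\}.$$ Let $\Phi\colon\mathbb{R}^N\to\mathbb{R}$ be strictly convex and symmetric (invariant under permutations of the coordinates). **Theorem.** Let $\pi^*$ be an allocation whose utility vector is a $\Phi$-minimizer over $\mathbf{B}_E$, that is, it belongs to $\mathbf{B}_E$ and minimizes $\Phi$ over $\mathbf{B}_E$. Then for every $j=1,\dots,q$ and every good $e\in M_j\cup C_j$, $$\sum_{i\in N_j}\pi^*_{ie}=1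 .$$ -/

import Mathlib

open scoped Pointwise

namespace MixedFair

/-! ### Set functions, base-polyhedra, M-convex sets -/

/-- Supermodular (integer-valued) set functions on the subsets of `N`. -/
def IsSupermodular {N : Type*} [DecidableEq N] (f : Finset N → ℤ) : Prop :=
  ∀ X Y : Finset N, f X + f Y ≤ f (X ∪ Y) + f (X ∩ Y)

/-- The integral base-polyhedron of `f`:
all `x ∈ ℝ^N` with `x(N) = f(N)` and `x(X) ≥ f(X)` for every `X ⊆ N`. -/
def basePolyhedron {N : Type*} [Fintype N] (f : Finset N → ℤ) : Set (N → ℝ) :=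
  {x | ∑ i, x i = f Finset.univ ∧ ∀ X : Finset N, (f X : ℝ) ≤ ∑ i ∈ X, x i}

/-- The M-convex set of `f`: the integer vectors of the base-polyhedron of `f`. -/
def mConvexSet {N : Type*} [Fintype N] (f : Finset N → ℤ) : Set (N → ℝ) :=
  {x | x ∈ basePolyhedron f ∧ ∀ i, ∃ k : ℤ, x i = k}

/-! ### The canonical partition of a set function -/

/-- `X` maximizes `f(X) - β |X|` over all subsets of `N`. -/
def IsLevelMaximizer {N : Type*} (f : Finset N → ℤ) (β : ℤ) (X : Finset N) : Prop :=
  ∀ Y : Finset N, f Y - β * (Y.card : ℤ) ≤ f X - β * (X.card : ℤ)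

open Classical in
/-- `L(β)`, the smallest maximizer of `f(X) - β |X|`, written as the intersection of all the
maximizers. For supermodular `f` it is itself a maximizer, see `isLeast_smallestMaximizer`. -/
noncomputable def smallestMaximizer {N : Type*} [Fintype N] (f : Finset N → ℤ) (β : ℤ) :
    Finset N :=
  Finset.univ.filter fun i => ∀ X : Finset N, IsLevelMaximizer f β X → i ∈ X

theorem isLevelMaximizer_inter {N : Type*} [DecidableEq N] {f : Finset N → ℤ}
    (hf : IsSupermodular f) {β : ℤ} {X Y : Finset N}
    (hX : IsLevelMaximizer f β X) (hY : IsLevelMaximizer f β Y) :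
    IsLevelMaximizer f β (X ∩ Y) := by
  intro Z
  have h1 := hX Z
  have h2 := hY (X ∪ Y)
  have h3 := hf X Y
  have h4 : ((X ∪ Y).card : ℤ) + ((X ∩ Y).card : ℤ) = X.card + Y.card := by
    exact_mod_cast Finset.card_union_add_card_inter X Y
  have h5 : β * ((X ∪ Y).card : ℤ) + β * ((X ∩ Y).card : ℤ) = β * X.card + β * Y.card := by
    rw [← mul_add, h4, mul_add]
  linarith

theorem isLeast_smallestMaximizer {N : Type*} [Fintype N] [DecidableEq N] {f : Finset N → ℤ}
    (hf : IsSupermodular f) (β : ℤ) :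
    IsLeast {X | IsLevelMaximizer f β X} (smallestMaximizer f β) := by
  obtain ⟨X₀, hX₀⟩ : ∃ X, IsLevelMaximizer f β X := by
    obtain ⟨X, -, hX⟩ := Finset.exists_max_image (Finset.univ : Finset (Finset N))
      (fun X => f X - β * (X.card : ℤ)) ⟨∅, Finset.mem_univ _⟩
    exact ⟨X, fun Y => hX Y (Finset.mem_univ _)⟩
  obtain ⟨X, hX, hmin⟩ := (Set.toFinite {X | IsLevelMaximizer f β X}).exists_minimalFor
    Finset.card _ ⟨X₀, hX₀⟩
  have hle : ∀ Y, IsLevelMaximizer f β Y → X ⊆ Y := by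
    intro Y hY
    have h := hmin (isLevelMaximizer_inter hf hX hY) (Finset.card_le_card Finset.inter_subset_left)
    exact Finset.inter_eq_left.mp (Finset.eq_of_subset_of_card_le Finset.inter_subset_left h)
  have heq : smallestMaximizer f β = X := by
    ext i
    simp only [smallestMaximizer, Finset.mem_filter, Finset.mem_univ, true_and]
    exact ⟨fun h => h X hX, fun h Y hY => hle Y hY h⟩
  rw [heq]
  exact ⟨hX, hle⟩

/-- `β ∈ ℤ` is an essential value of `f` if `L(β) ≠ L(β - 1)`. -/
def IsEssential {N : Type*} [Fintype N] (f : Finset N → ℤ) (β : ℤ) : Prop :=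
  smallestMaximizer f β ≠ smallestMaximizer f (β - 1)

/-- There are only finitely many essential values, since `L(β)` is empty for large `β` and all of
`N` for very negative `β`. -/
theorem finite_isEssential {N : Type*} [Fintype N] (f : Finset N → ℤ) :
    {β : ℤ | IsEssential f β}.Finite := by
  classical
  obtain ⟨S, hS⟩ : ∃ S : ℤ, ∀ X Y, f X - f Y ≤ S := by
    have hb : ∀ X, |f X| ≤ ∑ X, |f X| := fun X =>
      Finset.single_le_sum (f := fun X => |f X|) (fun _ _ => abs_nonneg _) (Finset.mem_univ X)
    refine ⟨2 * ∑ X, |f X|, fun X Y => ?_⟩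
    have h1 := (abs_le.mp (hb X)).2
    have h2 := (abs_le.mp (hb Y)).1
    linarith
  have hbig : ∀ β, S < β → smallestMaximizer f β = ∅ := by
    intro β hβ
    have hS0 : 0 ≤ S := by simpa using hS ∅ ∅
    refine Finset.eq_empty_of_forall_notMem fun i hi => ?_
    simp only [smallestMaximizer, Finset.mem_filter, Finset.mem_univ, true_and] at hi
    refine absurd (hi ∅ fun Y => ?_) (Finset.notMem_empty i)
    rcases Y.eq_empty_or_nonempty with rfl | hY
    · exact le_rfl
    · have hc : (1 : ℤ) ≤ Y.card := by exact_mod_cast hY.card_pos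
      have := hS Y ∅
      simp only [Finset.card_empty, Nat.cast_zero, mul_zero]
      nlinarith
  have hsmall : ∀ β, β < -S → smallestMaximizer f β = Finset.univ := by
    intro β hβ
    have hS0 : 0 ≤ S := by simpa using hS ∅ ∅
    ext i
    simp only [smallestMaximizer, Finset.mem_filter, Finset.mem_univ, true_and, iff_true]
    intro X hX
    by_contra hi
    have hc : (X.card : ℤ) + 1 ≤ (Finset.univ : Finset N).card := by
      exact_mod_cast Finset.card_lt_card
        (Finset.ssubset_univ_iff.mpr fun h : X = Finset.univ => hi (by rw [h]; exact Finset.mem_univ i))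
    have h1 := hX Finset.univ
    have h2 := hS X Finset.univ
    nlinarith
  refine (Set.finite_Icc (-S) (S + 1)).subset fun β hβ => ?_
  by_contra hmem
  rw [Set.mem_Icc, not_and_or, not_le, not_le] at hmem
  rcases hmem with h | h
  · exact hβ ((hsmall β h).trans (hsmall (β - 1) (by linarith)).symm)
  · exact hβ ((hbig β (by linarith)).trans (hbig (β - 1) (by linarith)).symm)

/-- The finite set of essential values of `f`. -/
noncomputable def essentialValues {N : Type*} [Fintype N] (f : Finset N → ℤ) : Finset ℤ :=
  (finite_isEssential f).toFinset

/-- The number `q` of classes of the canonical partition. -/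
noncomputable def numClasses {N : Type*} [Fintype N] (f : Finset N → ℤ) : ℕ :=
  (essentialValues f).card

/-- The essential values listed in decreasing order, `β_1 > β_2 > ⋯ > β_q`
(the indices `1, …, q` are represented by `Fin q`). -/
noncomputable def essentialValue {N : Type*} [Fintype N] (f : Finset N → ℤ)
    (j : Fin (numClasses f)) : ℤ :=
  (essentialValues f).orderEmbOfFin rfl j.rev

open Classical in
/-- The `j`-th class `N_j = L(β_j - 1) \ L(β_j)` of the canonical partition. -/
noncomputable def canonicalClass {N : Type*} [Fintype N] (f : Finset N → ℤ)
    (j : Fin (numClasses f)) : Finset N :=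
  smallestMaximizer f (essentialValue f j - 1) \ smallestMaximizer f (essentialValue f j)

/-- Given a list `P_1, …, P_q` of sets of agents and valuations `w` of a set `G` of goods, the
induced classes of goods, defined recursively: `G_j` is the set of the goods outside
`G_1 ∪ ⋯ ∪ G_{j-1}` that have value `0` for all the agents outside `P_1 ∪ ⋯ ∪ P_j`. -/
def inducedClass {N G : Type*} {q : ℕ} (P : Fin q → Finset N) (w : N → G → ℕ) (j : Fin q) :
    Set G :=
  {g | (∀ j' : Fin q, ∀ _ : j' < j, g ∉ inducedClass P w j') ∧
    ∀ i : N, (∀ j' : Fin q, j' ≤ j → i ∉ P j') → w i g = 0}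
termination_by j.val

/-- The number of goods (among those in `G`) that must be allocated to agents in `X`, since all
the agents outside `X` value them `0`. -/
noncomputable def forcedCount {N G : Type*} (w : N → G → ℕ) (X : Finset N) : ℤ :=
  (Set.ncard {g : G | ∀ i, i ∉ X → w i g = 0} : ℤ)

theorem isSupermodular_forcedCount {N G : Type*} [DecidableEq N] [Finite G] (w : N → G → ℕ) :
    IsSupermodular (forcedCount w) := by
  intro X Y
  have hinter : {g : G | ∀ i, i ∉ X ∩ Y → w i g = 0} =
      {g : G | ∀ i, i ∉ X → w i g = 0} ∩ {g : G | ∀ i, i ∉ Y → w i g = 0} := by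
    ext g
    simp only [Finset.mem_inter, Set.mem_inter_iff, Set.mem_ofPred_eq]
    exact ⟨fun h => ⟨fun i hi => h i fun h' => hi h'.1, fun i hi => h i fun h' => hi h'.2⟩,
      fun h i hi => by
        by_cases hX : i ∈ X
        · exact h.2 i fun hY => hi ⟨hX, hY⟩
        · exact h.1 i hX⟩
  have hunion : {g : G | ∀ i, i ∉ X → w i g = 0} ∪ {g : G | ∀ i, i ∉ Y → w i g = 0} ⊆
      {g : G | ∀ i, i ∉ X ∪ Y → w i g = 0} := by
    rintro g (h | h) i hi
    · exact h i fun h' => hi (Finset.mem_union_left _ h')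
    · exact h i fun h' => hi (Finset.mem_union_right _ h')
  have h1 := Set.ncard_union_add_ncard_inter
    {g : G | ∀ i, i ∉ X → w i g = 0} {g : G | ∀ i, i ∉ Y → w i g = 0}
  have h2 := Set.ncard_le_ncard hunion (Set.toFinite _)
  unfold forcedCount
  rw [hinter]
  exact_mod_cast h1.symm.le.trans (Nat.add_le_add_right h2 _)

/-! ### Fair allocation of mixed goods with binary valuations -/

/-- An instance with agents `N`, indivisible goods `M` and divisible goods `C`; the set of all
goods is `E = M ⊕ C`. Valuations are binary and every good is valued by some agent. -/
structure FairInstance (N M C : Type*) where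
  /-- `v i e` is the value of the whole good `e` for agent `i`. -/
  v : N → M ⊕ C → ℕ
  binary : ∀ i e, v i e = 0 ∨ v i e = 1
  desired : ∀ e, ∃ i, v i e = 1

namespace FairInstance

/-- `f_M(X)`: the number of indivisible goods that must be allocated to agents in `X`. -/
noncomputable def fM {N M C : Type*} (I : FairInstance N M C) (X : Finset N) : ℤ :=
  forcedCount (fun i (g : M) => I.v i (Sum.inl g)) X

/-- `f_C(X)`: the number of divisible goods that must be allocated to agents in `X`. -/
noncomputable def fC {N M C : Type*} (I : FairInstance N M C) (X : Finset N) : ℤ :=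
  forcedCount (fun i (c : C) => I.v i (Sum.inr c)) X

/-- `f_E = f_M + f_C`. -/
noncomputable def fE {N M C : Type*} (I : FairInstance N M C) (X : Finset N) : ℤ :=
  I.fM X + I.fC X

theorem isSupermodular_fE {N M C : Type*} [DecidableEq N] [Finite M] [Finite C]
    (I : FairInstance N M C) : IsSupermodular I.fE := by
  intro X Y
  have h1 : I.fM X + I.fM Y ≤ I.fM (X ∪ Y) + I.fM (X ∩ Y) := isSupermodular_forcedCount _ X Y
  have h2 : I.fC X + I.fC Y ≤ I.fC (X ∪ Y) + I.fC (X ∩ Y) := isSupermodular_forcedCount _ X Y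
  simp only [fE]
  linarith

/-- `B_E`, the Minkowski sum of the M-convex set of `f_M` and the base-polyhedron of `f_C`. -/
def utilitySet {N M C : Type*} [Fintype N] (I : FairInstance N M C) : Set (N → ℝ) :=
  mConvexSet I.fM + basePolyhedron I.fC

/-- Allocations: `π i e` is the fraction of good `e` given to agent `i`; goods are given completely,
no agent gets a positive fraction of a good of value `0`, indivisible goods are not split. -/
structure IsAllocation {N M C : Type*} [Fintype N] (I : FairInstance N M C)
    (π : N → M ⊕ C → ℝ) : Prop where
  mem_Icc : ∀ i e, π i e ∈ Set.Icc (0 : ℝ) 1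
  sum_eq_one : ∀ e, ∑ i, π i e = 1
  eq_zero : ∀ i e, I.v i e = 0 → π i e = 0
  integral : ∀ i (g : M), π i (Sum.inl g) = 0 ∨ π i (Sum.inl g) = 1

/-- The number `q` of classes of the canonical partition of the agents. -/
noncomputable def numClasses {N M C : Type*} [Fintype N] (I : FairInstance N M C) : ℕ :=
  MixedFair.numClasses I.fE

/-- The canonical partition `N_1, …, N_q` of the agents, which is that of `f_E`. -/
noncomputable def agentClass {N M C : Type*} [Fintype N] (I : FairInstance N M C)
    (j : Fin I.numClasses) : Finset N :=
  canonicalClass I.fE j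

/-- The canonical partition `M_1, …, M_q` of the indivisible goods. -/
noncomputable def indivisibleClass {N M C : Type*} [Fintype N] (I : FairInstance N M C)
    (j : Fin I.numClasses) : Set M :=
  inducedClass I.agentClass (fun i (g : M) => I.v i (Sum.inl g)) j

/-- The canonical partition `C_1, …, C_q` of the divisible goods. -/
noncomputable def divisibleClass {N M C : Type*} [Fintype N] (I : FairInstance N M C)
    (j : Fin I.numClasses) : Set C :=
  inducedClass I.agentClass (fun i (c : C) => I.v i (Sum.inr c)) j

end FairInstance

/-- The utility vector `π(E)` of an allocation `π`. -/
def utility {N E : Type*} [Fintype E] (π : N → E → ℝ) : N → ℝ :=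
  fun i => ∑ e, π i e

/-- `Φ : ℝ^N → ℝ` is symmetric: invariant under permutations of the coordinates. -/
def IsSymmetric {N : Type*} (Φ : (N → ℝ) → ℝ) : Prop :=
  ∀ (σ : Equiv.Perm N) (z : N → ℝ), Φ (fun i => z (σ i)) = Φ z

/-- `z` is a `Φ`-minimizer over `B`. -/
def IsPhiMinimizer {N : Type*} (Φ : (N → ℝ) → ℝ) (B : Set (N → ℝ)) (z : N → ℝ) : Prop :=
  z ∈ B ∧ ∀ w ∈ B, Φ z ≤ Φ w

end MixedFair

/-! ### Transfers and symmetric strictly convex functions. -/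

namespace MixedFair

/-! The theorem reduces to a tightness statement: for every integer β, the agents of L(β) hold only
goods that nobody outside L(β) values (`eq_zero_of_mem_smallestMaximizer`). Indeed L(β_j - 1) and
L(β_j) are N_1 ∪ ⋯ ∪ N_j and N_1 ∪ ⋯ ∪ N_{j-1}. A good of the j-th class has value 0 outside the
former, and somebody outside the latter values it, so tightness of L(β_j) leaves only N_j as
holders.

Let u be the utility vector and L = L(β). For tightness it is enough to find a set R that contains
all agents with u_i > β, no agent with u_i < β, and satisfies u(R) = f_E(R). Then f_E(L) - β|L| ≤
u(L) - β|L| ≤ u(R) - β|R| = f_E(R) - β|R| ≤ f_E(L) - β|L|, so u(L) = f_E(L).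

R is the set of agents reachable from those above β by passing on goods outside `movableGoods`. The
crux, `le_utility_of_reachable`, is that no such path joins some t above β to some s below β. All
holders of a divisible good have equal utility (`utility_le_of_divisible`), so a non-movable good is
indivisible or held only by agents of utility exactly β; hence every agent's amount of non-movable
goods is an integer. Hall's theorem (`exists_assignment_of_reachable`) then moves one whole unit
from t to s. This may overshoot β by less than one, which `exists_shift_row` repairs with the
movable goods, separately above and below β, without any other utility crossing β. Every utility has
moved weakly towards β and that of t strictly, so `lt_of_pull` contradicts minimality. -/

theorem lt_of_transfer {N : Type*} [DecidableEq N] {Φ : (N → ℝ) → ℝ} (hsymm : IsSymmetric Φ)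
    (hconv : StrictConvexOn ℝ Set.univ Φ) {z w : N → ℝ} {s t : N} {δ : ℝ} (hδ : 0 < δ)
    (hle : z s + δ ≤ z t - δ) (hs : w s = z s + δ) (ht : w t = z t - δ)
    (hw : ∀ i, i ≠ s → i ≠ t → w i = z i) : Φ w < Φ z := by
  have hgap : 0 < z t - z s := by linarith
  have hst : s ≠ t := by rintro rfl; linarith
  set z' : N → ℝ := fun i => z (Equiv.swap s t i) with hz'
  set r : ℝ := δ / (z t - z s) with hr
  have hr0 : 0 < r := div_pos hδ hgap
  have hr1 : r < 1 := by rw [hr, div_lt_one hgap]; linarith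
  have hrm : r * (z t - z s) = δ := div_mul_cancel₀ _ hgap.ne'
  have hne : z ≠ z' := by
    intro h
    have := congrFun h s
    simp only [hz', Equiv.swap_apply_left] at this
    linarith
  -- The transfer is a proper convex combination of z and its transposition at s and t, which have
  -- the same Φ-value.
  have hwz : w = (1 - r) • z + r • z' := by
    ext i
    simp only [Pi.add_apply, Pi.smul_apply, smul_eq_mul, hz']
    by_cases his : i = s
    · subst his; rw [Equiv.swap_apply_left, hs]; linarith
    by_cases hit : i = t
    · subst hit; rw [Equiv.swap_apply_right, ht]; linarith
    · rw [Equiv.swap_apply_of_ne_of_ne his hit, hw i his hit]; ring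
  have h := hconv.2 (Set.mem_univ z) (Set.mem_univ z') hne (sub_pos.2 hr1) hr0 (by ring)
  rw [← hwz] at h
  have hs' : Φ z' = Φ z := hsymm (Equiv.swap s t) z
  rw [hs'] at h
  simp only [smul_eq_mul] at h
  linarith

/-- Moving every coordinate towards a common value `b`, without changing the sum, decreases a
symmetric strictly convex function. -/
theorem lt_of_pull {N : Type*} [Fintype N] {Φ : (N → ℝ) → ℝ} (hsymm : IsSymmetric Φ)
    (hconv : StrictConvexOn ℝ Set.univ Φ) (b : ℝ) {z w : N → ℝ}
    (hzw : ∀ i, (b ≤ w i ∧ w i ≤ z i) ∨ (z i ≤ w i ∧ w i ≤ b))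
    (hsum : ∑ i, w i = ∑ i, z i) (hne : w ≠ z) : Φ w < Φ z := by
  classical
  induction hn : (Finset.univ.filter fun i => w i ≠ z i).card using Nat.strong_induction_on
    generalizing z with
  | _ n ih =>
    obtain ⟨t, ht⟩ : ∃ t, w t < z t := by
      by_contra! h
      exact hne (funext fun i =>
        ((Finset.sum_eq_sum_iff_of_le fun i _ => h i).1 hsum.symm i (Finset.mem_univ i)).symm)
    obtain ⟨s, hs⟩ : ∃ s, z s < w s := by
      by_contra! h
      exact hne (funext fun i =>
        (Finset.sum_eq_sum_iff_of_le fun i _ => h i).1 hsum i (Finset.mem_univ i))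
    have hst : s ≠ t := by rintro rfl; linarith
    -- The smaller outstanding change: neither coordinate overshoots its target, and at least one
    -- reaches it, so fewer coordinates differ afterwards.
    set δ := min (z t - w t) (w s - z s) with hδ
    have hδ0 : 0 < δ := lt_min (by linarith) (by linarith)
    have hδt : δ ≤ z t - w t := min_le_left _ _
    have hδs : δ ≤ w s - z s := min_le_right _ _
    have hwt : b ≤ w t := by rcases hzw t with h | h <;> linarith [h.1, h.2]
    have hws : w s ≤ b := by rcases hzw s with h | h <;> linarith [h.1, h.2]
    set u : N → ℝ := Function.update (Function.update z s (z s + δ)) t (z t - δ) with hu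
    have hut : u t = z t - δ := by simp [hu]
    have hus : u s = z s + δ := by simp [hu, hst]
    have huo : ∀ i, i ≠ s → i ≠ t → u i = z i := fun i h1 h2 => by simp [hu, h1, h2]
    have hlt : Φ u < Φ z := lt_of_transfer hsymm hconv hδ0 (by linarith) hus hut huo
    by_cases hwu : w = u
    · rwa [hwu]
    refine lt_trans (ih _ ?_ ?_ ?_ hwu rfl) hlt
    · rw [← hn]
      apply Finset.card_lt_card
      rw [Finset.ssubset_iff_of_subset]
      · rcases min_choice (z t - w t) (w s - z s) with h | h
        · refine ⟨t, by simp [ht.ne], ?_⟩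
          have : u t = w t := by rw [hut, hδ, h]; ring
          simp [this]
        · refine ⟨s, by simp [hs.ne'], ?_⟩
          have : u s = w s := by rw [hus, hδ, h]; ring
          simp [this]
      · intro i
        simp only [Finset.mem_filter, Finset.mem_univ, true_and]
        intro h
        by_cases his : i = s
        · subst his; exact hs.ne'
        by_cases hit : i = t
        · subst hit; exact ht.ne
        rwa [huo i his hit] at h
    · intro i
      by_cases his : i = s
      · subst his; right; rw [hus]; constructor <;> linarith
      by_cases hit : i = t
      · subst hit; left; rw [hut]; constructor <;> linarith
      rw [huo i his hit]; exact hzw i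
    · rw [hsum]
      have : ∀ i, u i = z i + ((if i = s then δ else 0) - (if i = t then δ else 0)) := by
        intro i
        by_cases his : i = s
        · subst his; rw [hus]; simp [hst]
        by_cases hit : i = t
        · subst hit; rw [hut]; simp [his, sub_eq_add_neg]
        rw [huo i his hit]; simp [his, hit]
      simp [this, Finset.sum_add_distrib]

/-! ### Integral assignments -/

/-- If `y` assigns goods fractionally with integral row sums `r`, and `s` can be reached from `t`
by passing on goods, then some integral assignment has row sums `r - χ_t + χ_s`. -/
theorem exists_assignment_of_reachable {N G : Type*} [Fintype N] [Fintype G] [DecidableEq N]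
    (V : N → G → Prop) {y : N → G → ℝ} (hy : ∀ i g, 0 ≤ y i g) (hcol : ∀ g, ∑ i, y i g = 1)
    (hV : ∀ i g, 0 < y i g → V i g) {r : N → ℕ} (hr : ∀ i, ∑ g, y i g = r i) {s t : N}
    (hst : s ≠ t) (hreach : Relation.ReflTransGen (fun i k => ∃ g, 0 < y i g ∧ V k g) t s) :
    ∃ h : G → N, (∀ g, V (h g) g) ∧
      ∀ i, ∑ g, (if h g = i then (1 : ℝ) else 0)
        = r i - (if i = t then 1 else 0) + (if i = s then 1 else 0) := by
  classical
  have hrt : 1 ≤ r t := by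
    rcases hreach.cases_head with h | ⟨k, ⟨g, hg, -⟩, -⟩
    · exact absurd h.symm hst
    · have : (0 : ℝ) < r t := by
        rw [← hr]
        exact Finset.sum_pos' (fun g _ => hy t g) ⟨g, Finset.mem_univ _, hg⟩
      exact_mod_cast this
  set r' : N → ℕ := fun i => r i - (if i = t then 1 else 0) + (if i = s then 1 else 0) with hr'
  have hr'c : ∀ i, (r' i : ℝ) = r i - (if i = t then 1 else 0) + (if i = s then 1 else 0) := by
    intro i
    simp only [hr']
    by_cases hit : i = t
    · subst hit; simp [hst.symm, Nat.cast_sub hrt]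
    · simp [hit]
  have hsumr : ∑ i, (r i : ℝ) = Fintype.card G := by
    simp_rw [← hr]
    rw [Finset.sum_comm]
    simp [hcol]
  have hsumr' : ∑ i, r' i = Fintype.card G := by
    have : ∑ i, (r' i : ℝ) = Fintype.card G := by
      simp only [hr'c, Finset.sum_add_distrib, Finset.sum_sub_distrib]
      simp [hsumr]
    exact_mod_cast this
  -- Agent i offers `r' i` slots. There are as many slots as goods, so an injective choice of slots
  -- fills all of them.
  let slots : G → Finset (Σ i, Fin (r' i)) := fun g => Finset.univ.filter fun p => V p.1 g
  have hhall : ∀ A : Finset G, A.card ≤ (A.biUnion slots).card := by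
    intro A
    set X : Finset N := Finset.univ.filter fun i => ∃ g ∈ A, V i g with hX
    have hcard : (A.biUnion slots).card = ∑ i ∈ X, r' i := by
      have : A.biUnion slots = X.sigma fun i => (Finset.univ : Finset (Fin (r' i))) := by
        ext p
        simp [slots, hX]
      rw [this, Finset.card_sigma]
      simp
    rw [hcard]
    have hA : ∀ g ∈ A, ∑ i ∈ X, y i g = 1 := by
      intro g hg
      rw [← hcol g]
      refine Finset.sum_subset (Finset.subset_univ _) fun i _ hi => ?_
      refine le_antisymm (not_lt.1 fun h => hi ?_) (hy i g)
      simp only [hX, Finset.mem_filter, Finset.mem_univ, true_and]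
      exact ⟨g, hg, hV i g h⟩
    -- The goods of A are held entirely inside X, so Hall's condition can fail only if t ∈ X, s ∉ X
    -- and X holds nothing outside A.
    have hsplit : ∑ i ∈ X, (r i : ℝ) = A.card + ∑ g ∈ Aᶜ, ∑ i ∈ X, y i g := by
      simp_rw [← hr]
      rw [Finset.sum_comm, ← Finset.sum_add_sum_compl A, Finset.sum_congr rfl hA]
      simp
    have hnn : 0 ≤ ∑ g ∈ Aᶜ, ∑ i ∈ X, y i g :=
      Finset.sum_nonneg fun g _ => Finset.sum_nonneg fun i _ => hy i g
    have hsum' : ∑ i ∈ X, (r' i : ℝ) = ∑ i ∈ X, (r i : ℝ) - (if t ∈ X then 1 else 0)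
        + (if s ∈ X then 1 else 0) := by
      simp only [hr'c, Finset.sum_add_distrib, Finset.sum_sub_distrib]
      simp
    by_contra! hlt
    have hlt' : ∑ i ∈ X, (r' i : ℝ) + 1 ≤ A.card := by exact_mod_cast hlt
    by_cases hsX : s ∈ X
    · rw [hsum', if_pos hsX] at hlt'
      split_ifs at hlt' <;> linarith
    by_cases htX : t ∈ X
    · rw [hsum', if_neg hsX, if_pos htX] at hlt'
      have hzero : ∑ g ∈ Aᶜ, ∑ i ∈ X, y i g = 0 := by linarith
      -- Agents in X now hold only goods of A, and everyone valuing a good of A is in X, so a path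
      -- from t cannot leave X.
      suffices h : ∀ k, Relation.ReflTransGen (fun i k => ∃ g, 0 < y i g ∧ V k g) t k → k ∈ X from
        hsX (h s hreach)
      intro k hk
      induction hk with
      | refl => exact htX
      | @tail i k _ hik ih =>
        obtain ⟨g, hg, hk⟩ := hik
        have hgA : g ∈ A := by
          by_contra hgA
          have h1 := (Finset.sum_eq_zero_iff_of_nonneg fun g _ =>
            Finset.sum_nonneg fun i _ => hy i g).1 hzero g (Finset.mem_compl.2 hgA)
          have h2 := (Finset.sum_eq_zero_iff_of_nonneg fun i _ => hy i g).1 h1 i ih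
          linarith
        simp only [hX, Finset.mem_filter, Finset.mem_univ, true_and]
        exact ⟨g, hgA, hk⟩
    · rw [hsum', if_neg hsX, if_neg htX] at hlt'
      linarith
  obtain ⟨f, hf, hfs⟩ := (Finset.all_card_le_biUnion_card_iff_exists_injective slots).1 hhall
  have hle : ∀ i, (Finset.univ.filter fun g => (f g).1 = i).card ≤ r' i := by
    intro i
    have : (Finset.univ.filter fun g => (f g).1 = i).card
        ≤ (({i} : Finset N).sigma fun i => (Finset.univ : Finset (Fin (r' i)))).card := by
      refine Finset.card_le_card_of_injOn f ?_ hf.injOn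
      intro g hg
      simpa using hg
    simpa [Finset.card_sigma] using this
  have hsumc : ∑ i, (Finset.univ.filter fun g => (f g).1 = i).card = ∑ i, r' i := by
    rw [hsumr', ← Finset.card_univ]
    exact (Finset.card_eq_sum_card_fiberwise fun _ _ => Finset.mem_coe.2 (Finset.mem_univ _)).symm
  refine ⟨fun g => (f g).1, fun g => by simpa [slots] using hfs g, fun i => ?_⟩
  have := (Finset.sum_eq_sum_iff_of_le fun i _ => hle i).1 hsumc i (Finset.mem_univ i)
  rw [← hr'c, ← this]
  simp

/-- A fractional assignment `y` with integral column sums can be changed inside its support so that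
the row sum of `t` (times a sign `σ`) reaches the next integer `m`, while the other row sums inside
`P`, a union of connected components of the support, only decrease and stay above the integral
bounds `l`. -/
theorem exists_shift_row {N G : Type*} [Fintype N] [Fintype G] {y : N → G → ℝ}
    (hy : ∀ i g, 0 ≤ y i g) (b : G → ℤ) (hcol : ∀ g, ∑ i, y i g = b g) (P : Set N)
    (hP : ∀ i k g, 0 < y i g → 0 < y k g → i ∈ P → k ∈ P) {t : N} (ht : t ∈ P) (l : N → ℤ)
    {σ : ℤ} (hσ : σ * σ = 1) (hl : ∀ i ∈ P, (l i : ℝ) ≤ σ * ∑ g, y i g) (m : ℤ)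
    (hm : (m : ℝ) - 1 < σ * ∑ g, y t g) :
    ∃ y' : N → G → ℝ, (∀ i g, 0 ≤ y' i g) ∧ (∀ g, ∑ i, y' i g = b g) ∧
      (∀ i g, 0 < y' i g → 0 < y i g) ∧ (∀ i ∉ P, ∑ g, y' i g = ∑ g, y i g) ∧
      (∀ i ∈ P, i ≠ t → (l i : ℝ) ≤ σ * ∑ g, y' i g ∧ σ * ∑ g, y' i g ≤ σ * ∑ g, y i g) ∧
      m ≤ σ * ∑ g, y' t g ∧ σ * ∑ g, y' t g ≤ max (m : ℝ) (σ * ∑ g, y t g) := by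
  classical
  have hσ' : (σ : ℝ) * σ = 1 := by exact_mod_cast hσ
  rcases le_or_gt (m : ℝ) (σ * ∑ g, y t g) with hmt | hmt
  · exact ⟨y, hy, hcol, fun _ _ h => h, fun _ _ => rfl, fun i hi _ => ⟨hl i hi, le_rfl⟩, hmt,
      le_max_right _ _⟩
  -- The admissible changes form a compact polytope; a maximizer of σ times the row sum of t is
  -- shown to attain m.
  set K : Set (N → G → ℝ) := {y' | (∀ i g, 0 ≤ y' i g) ∧ (∀ g, ∑ i, y' i g = b g) ∧
      (∀ i g, y i g = 0 → y' i g = 0) ∧ (∀ i, i ∉ P → ∑ g, y' i g = ∑ g, y i g) ∧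
      (∀ i, i ∈ P → i ≠ t →
        (l i : ℝ) ≤ σ * ∑ g, y' i g ∧ σ * ∑ g, y' i g ≤ σ * ∑ g, y i g) ∧
      σ * ∑ g, y' t g ≤ m} with hK
  have hclosed : IsClosed K := by
    have hc : ∀ i g, Continuous fun y' : N → G → ℝ => y' i g := fun i g => by fun_prop
    have hrow : ∀ i, Continuous fun y' : N → G → ℝ => ∑ g, y' i g := fun i => by fun_prop
    have hcl : ∀ g, Continuous fun y' : N → G → ℝ => ∑ i, y' i g := fun i => by fun_prop
    simp only [hK, Set.ofPred_and, Set.ofPred_forall]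
    refine IsClosed.inter (isClosed_iInter fun i => isClosed_iInter fun g =>
        isClosed_le continuous_const (hc i g)) <|
      IsClosed.inter (isClosed_iInter fun g => isClosed_eq (hcl g) continuous_const) <|
      IsClosed.inter (isClosed_iInter fun i => isClosed_iInter fun g => isClosed_iInter fun _ =>
        isClosed_eq (hc i g) continuous_const) <|
      IsClosed.inter (isClosed_iInter fun i => isClosed_iInter fun _ =>
        isClosed_eq (hrow i) continuous_const) <|
      IsClosed.inter (isClosed_iInter fun i => isClosed_iInter fun _ => isClosed_iInter fun _ =>
        IsClosed.inter (isClosed_le continuous_const (continuous_const.mul (hrow i)))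
          (isClosed_le (continuous_const.mul (hrow i)) continuous_const)) <|
      isClosed_le (continuous_const.mul (hrow t)) continuous_const
  have hcompact : IsCompact K := by
    refine IsCompact.of_isClosed_subset
      (isCompact_Icc (a := (0 : N → G → ℝ)) (b := fun _ g => (b g : ℝ))) hclosed ?_
    rintro y' ⟨h0, h1, -⟩
    refine ⟨fun i g => h0 i g, fun i g => ?_⟩
    change y' i g ≤ (b g : ℝ)
    rw [← h1 g]
    exact Finset.single_le_sum (f := fun i => y' i g) (fun i _ => h0 i g) (Finset.mem_univ i)
  have hyK : y ∈ K := ⟨hy, hcol, fun _ _ h => h, fun _ _ => rfl,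
    fun i hi _ => ⟨hl i hi, le_rfl⟩, hmt.le⟩
  obtain ⟨x, ⟨hx0, hxcol, hxsupp, hxout, hxin, hxt⟩, hmax⟩ :=
    hcompact.exists_isMaxOn (f := fun y' : N → G → ℝ => σ * ∑ g, y' t g) ⟨y, hyK⟩
      (by fun_prop)
  have hxsupp' : ∀ i g, 0 < x i g → 0 < y i g := fun i g h =>
    lt_of_le_of_ne (hy i g) fun h' => h.ne' (hxsupp i g h'.symm)
  suffices hxm : (m : ℝ) ≤ σ * ∑ g, x t g from
    ⟨x, hx0, hxcol, hxsupp', hxout, hxin, hxm, hxt.trans (le_max_left _ _)⟩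
  by_contra! hlt
  -- The agents that can exchange a unit with t inside the support of x; δ is the direction, signed
  -- so that it raises σ times the row sum of t.
  set U : Finset N := Finset.univ.filter fun u => u ∈ P ∧ ∃ δ : N → G → ℝ,
    (∀ i g, x i g = 0 → δ i g = 0) ∧ (∀ g, ∑ i, δ i g = 0) ∧
    ∀ i, ∑ g, δ i g = σ * ((if i = t then 1 else 0) - (if i = u then 1 else 0)) with hU
  have htU : t ∈ U := by
    simp only [hU, Finset.mem_filter, Finset.mem_univ, true_and]
    exact ⟨ht, 0, by simp, by simp, by simp⟩
  have hUclosed : ∀ u k g, u ∈ U → 0 < x u g → 0 < x k g → k ∈ U := by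
    intro u k g hu hug hkg
    simp only [hU, Finset.mem_filter, Finset.mem_univ, true_and] at hu ⊢
    obtain ⟨huP, δ, h1, h2, h3⟩ := hu
    refine ⟨hP u k g (hxsupp' _ _ hug) (hxsupp' _ _ hkg) huP,
      fun i g' => δ i g' + σ * (if g' = g then
        ((if i = u then 1 else 0) - (if i = k then 1 else 0)) else 0), ?_, ?_, ?_⟩
    · intro i g' hi
      dsimp only
      rw [h1 i g' hi]
      by_cases hg : g' = g
      · subst hg
        have hiu : i ≠ u := by rintro rfl; exact hug.ne' hi
        have hik : i ≠ k := by rintro rfl; exact hkg.ne' hi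
        simp [hiu, hik]
      · simp [hg]
    · intro g'
      by_cases hg : g' = g
      · simp [hg, Finset.sum_add_distrib, h2, ← Finset.mul_sum]
      · simp [hg, h2]
    · intro i
      rw [Finset.sum_add_distrib, h3, ← Finset.mul_sum]
      simp only [Finset.sum_ite_eq', Finset.mem_univ, if_true]
      ring
  -- A small step along δ would improve the maximizer x, so it must be blocked, and only the bound
  -- `l u` can block it.
  have hUl : ∀ u ∈ U, u ≠ t → σ * ∑ g, x u g = l u := by
    intro u hu hut
    simp only [hU, Finset.mem_filter, Finset.mem_univ, true_and] at hu
    obtain ⟨huP, δ, h1, h2, h3⟩ := hu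
    refine le_antisymm (not_lt.1 fun hgt => ?_) (hxin u huP hut).1
    have hev1 : ∀ᶠ ε : ℝ in nhdsWithin 0 (Set.Ioi 0), ∀ i g, 0 ≤ x i g + ε * δ i g := by
      refine Filter.eventually_all.2 fun i => Filter.eventually_all.2 fun g => ?_
      rcases (hx0 i g).eq_or_lt with h | h
      · simp [← h, h1 i g h.symm]
      · have hc : ContinuousAt (fun ε : ℝ => x i g + ε * δ i g) 0 := by fun_prop
        have := hc.eventually_const_lt (u := 0) (by simpa using h)
        exact (this.filter_mono nhdsWithin_le_nhds).mono fun _ h => h.le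
    have hev2 : ∀ᶠ ε : ℝ in nhdsWithin 0 (Set.Ioi 0), ε < σ * ∑ g, x u g - l u :=
      nhdsWithin_le_nhds (eventually_lt_nhds (sub_pos.2 hgt))
    have hev3 : ∀ᶠ ε : ℝ in nhdsWithin 0 (Set.Ioi 0), ε < m - σ * ∑ g, x t g :=
      nhdsWithin_le_nhds (eventually_lt_nhds (sub_pos.2 hlt))
    obtain ⟨ε, he1, he2, he3, he0⟩ :=
      (hev1.and (hev2.and (hev3.and self_mem_nhdsWithin))).exists
    have he0 : 0 < ε := he0
    have hrow : ∀ i, σ * ∑ g, (x i g + ε * δ i g) = σ * ∑ g, x i g +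
        ε * ((if i = t then 1 else 0) - (if i = u then 1 else 0)) := by
      intro i
      rw [Finset.sum_add_distrib, ← Finset.mul_sum, h3]
      linear_combination ε * ((if i = t then 1 else 0) - (if i = u then 1 else 0)) * hσ'
    have hσrow : ∀ i, i ≠ t → i ≠ u → ∑ g, (x i g + ε * δ i g) = ∑ g, x i g := by
      intro i hit hiu
      rw [Finset.sum_add_distrib, ← Finset.mul_sum, h3]
      simp [hit, hiu]
    have hnew : (fun i g => x i g + ε * δ i g) ∈ K := by
      refine ⟨he1, fun g => ?_, fun i g h => ?_, fun i hi => ?_, fun i hi hit => ?_, ?_⟩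
      · rw [Finset.sum_add_distrib, ← Finset.mul_sum, h2, hxcol]; simp
      · have := hxsupp i g h
        simp [this, h1 i g this]
      · rw [hσrow i (by rintro rfl; exact hi ht) (by rintro rfl; exact hi huP), hxout i hi]
      · by_cases hiu : i = u
        · subst hiu
          rw [hrow]
          have := (hxin i hi hit).2
          simp only [hit, if_false, if_true]
          constructor <;> linarith
        · rw [hσrow i hit hiu]
          exact hxin i hi hit
      · rw [hrow]
        simp only [hut.symm, if_false, if_true]
        linarith
    have := hmax hnew
    simp only [Set.mem_ofPred_eq] at this
    rw [hrow] at this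
    simp only [hut.symm, if_false, if_true] at this
    linarith
  -- U is closed under sharing a good, so its total is a sum of full column sums. As the other rows
  -- of U sit at integral bounds, σ times the row sum of t is an integer strictly between m - 1 and
  -- m.
  obtain ⟨n, hn⟩ : ∃ n : ℤ, ∑ u ∈ U, ∑ g, x u g = n := by
    refine ⟨∑ g, if ∃ u ∈ U, 0 < x u g then b g else 0, ?_⟩
    rw [Finset.sum_comm, Int.cast_sum]
    refine Finset.sum_congr rfl fun g _ => ?_
    split_ifs with h
    · obtain ⟨u, hu, hug⟩ := h
      rw [← hxcol g]
      refine Finset.sum_subset (Finset.subset_univ _) fun i _ hi => ?_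
      exact le_antisymm (not_lt.1 fun h => hi (hUclosed u i g hu hug h)) (hx0 i g)
    · push Not at h
      rw [Int.cast_zero]
      exact Finset.sum_eq_zero fun u hu => le_antisymm (h u hu) (hx0 u g)
  have hxt' : σ * ∑ g, x t g = ((σ * n - ∑ u ∈ U.erase t, l u : ℤ) : ℝ) := by
    push_cast
    have hrest : σ * ∑ u ∈ U.erase t, ∑ g, x u g = ∑ u ∈ U.erase t, (l u : ℝ) := by
      rw [Finset.mul_sum]
      exact Finset.sum_congr rfl fun u hu =>
        hUl u (Finset.mem_of_mem_erase hu) (Finset.ne_of_mem_erase hu)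
    rw [← hn, ← Finset.add_sum_erase _ _ htU, mul_add, hrest]
    ring
  have hge : σ * ∑ g, y t g ≤ σ * ∑ g, x t g := hmax hyK
  rw [hxt'] at hlt hge
  have h1 : σ * n - ∑ u ∈ U.erase t, l u < m := by exact_mod_cast hlt
  have h2 : (m : ℝ) - 1 < ((σ * n - ∑ u ∈ U.erase t, l u : ℤ) : ℝ) := hm.trans_le hge
  have h3 : m - 1 < σ * n - ∑ u ∈ U.erase t, l u := by exact_mod_cast h2
  omega

/-! ### Forced goods -/

open Classical in
/-- The agents in `X` receive the goods forced into `X`, and their share of the other goods. -/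
theorem sum_rows_eq_forcedCount_add {N G : Type*} [Fintype N] [Fintype G] {w : N → G → ℕ}
    {y : N → G → ℝ} (hcol : ∀ g, ∑ i, y i g = 1) (hw : ∀ i g, w i g = 0 → y i g = 0)
    (X : Finset N) :
    ∑ i ∈ X, ∑ g, y i g = forcedCount w X +
      ∑ g ∈ Finset.univ.filter (fun g => ¬ ∀ i, i ∉ X → w i g = 0), ∑ i ∈ X, y i g := by
  rw [Finset.sum_comm,
    ← Finset.sum_filter_add_sum_filter_not Finset.univ (fun g => ∀ i, i ∉ X → w i g = 0)]
  congr 1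
  have hone : ∀ g ∈ Finset.univ.filter (fun g => ∀ i, i ∉ X → w i g = 0),
      ∑ i ∈ X, y i g = 1 := by
    intro g hg
    rw [← hcol g]
    exact Finset.sum_subset (Finset.subset_univ _)
      fun i _ hi => hw i g ((Finset.mem_filter.1 hg).2 i hi)
  rw [Finset.sum_congr rfl hone]
  have : {g : G | ∀ i, i ∉ X → w i g = 0} =
      ((Finset.univ.filter fun g => ∀ i, i ∉ X → w i g = 0 : Finset G) : Set G) := by
    ext g; simp
  rw [forcedCount, this, Set.ncard_coe_finset]
  simp

theorem rows_mem_basePolyhedron {N G : Type*} [Fintype N] [Fintype G] {w : N → G → ℕ}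
    {y : N → G → ℝ} (hy : ∀ i g, 0 ≤ y i g) (hcol : ∀ g, ∑ i, y i g = 1)
    (hw : ∀ i g, w i g = 0 → y i g = 0) :
    (fun i => ∑ g, y i g) ∈ basePolyhedron (forcedCount w) := by
  classical
  constructor
  · rw [sum_rows_eq_forcedCount_add hcol hw]
    simp
  · intro X
    rw [sum_rows_eq_forcedCount_add hcol hw]
    have := Finset.sum_nonneg (s := Finset.univ.filter (fun g => ¬ ∀ i, i ∉ X → w i g = 0))
      fun g _ => Finset.sum_nonneg (s := X) fun i _ => hy i g
    linarith

/-- Makes every reallocation a competitor of the minimizer. The converse, realizing points of B_E by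
allocations, is not needed. -/
theorem FairInstance.IsAllocation.utility_mem {N M C : Type*} [Fintype N] [Fintype M] [Fintype C]
    {I : FairInstance N M C} {π : N → M ⊕ C → ℝ} (hπ : I.IsAllocation π) :
    utility π ∈ I.utilitySet := by
  refine Set.mem_add.2 ⟨fun i => ∑ g, π i (Sum.inl g), ⟨?_, fun i => ?_⟩,
    fun i => ∑ c, π i (Sum.inr c), ?_, ?_⟩
  · exact rows_mem_basePolyhedron (fun i g => (hπ.mem_Icc i _).1) (fun g => hπ.sum_eq_one _)
      fun i g => hπ.eq_zero i _
  · classical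
    refine ⟨∑ g, if π i (Sum.inl g) = 1 then 1 else 0, ?_⟩
    rw [Int.cast_sum]
    refine Finset.sum_congr rfl fun g _ => ?_
    rcases hπ.integral i g with h | h <;> simp [h]
  · exact rows_mem_basePolyhedron (fun i c => (hπ.mem_Icc i _).1) (fun c => hπ.sum_eq_one _)
      fun i c => hπ.eq_zero i _
  · ext i
    simp [utility, Fintype.sum_sum_type]

/-! ### The canonical partition -/

/-- If enlarging L(a) to L(a) ∪ L(b) does not pay at level a, it does not pay at a level b ≥ a. By
supermodularity L(a) ∩ L(b) then maximizes at level b, so it contains L(b). -/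
theorem smallestMaximizer_anti {N : Type*} [Fintype N] [DecidableEq N] {f : Finset N → ℤ}
    (hf : IsSupermodular f) : Antitone (smallestMaximizer f) := by
  intro a b hab
  obtain ⟨hX, hXle⟩ := isLeast_smallestMaximizer hf b
  obtain ⟨hY, -⟩ := isLeast_smallestMaximizer hf a
  set X := smallestMaximizer f b
  set Y := smallestMaximizer f a
  have hXY : IsLevelMaximizer f b (X ∩ Y) := by
    intro Z
    have h1 := hX Z
    have h2 := hY (X ∪ Y)
    have h3 := hf X Y
    have h4 : ((X ∪ Y).card : ℤ) + ((X ∩ Y).card : ℤ) = X.card + Y.card := by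
      exact_mod_cast Finset.card_union_add_card_inter X Y
    have h5 : (Y.card : ℤ) ≤ (X ∪ Y).card := by
      exact_mod_cast Finset.card_le_card Finset.subset_union_right
    have h6 := mul_nonneg (sub_nonneg.2 hab) (sub_nonneg.2 h5)
    have h7 : b * ((X ∪ Y).card : ℤ) + b * ((X ∩ Y).card : ℤ) = b * X.card + b * Y.card := by
      rw [← mul_add, h4, mul_add]
    linarith
  exact (hXle hXY).trans Finset.inter_subset_right

theorem exists_smallestMaximizer_eq_empty {N : Type*} [Fintype N] (f : Finset N → ℤ) :
    ∃ B, ∀ β, B ≤ β → smallestMaximizer f β = ∅ := by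
  classical
  refine ⟨∑ X, |f X - f ∅|, fun β hβ => ?_⟩
  refine Finset.eq_empty_of_forall_notMem fun i hi => ?_
  simp only [smallestMaximizer, Finset.mem_filter, Finset.mem_univ, true_and] at hi
  refine absurd (hi ∅ fun Y => ?_) (Finset.notMem_empty i)
  rcases Y.eq_empty_or_nonempty with rfl | hY
  · exact le_rfl
  · have hc : (1 : ℤ) ≤ Y.card := by exact_mod_cast hY.card_pos
    have h1 : |f Y - f ∅| ≤ ∑ X, |f X - f ∅| :=
      Finset.single_le_sum (f := fun X => |f X - f ∅|) (fun _ _ => abs_nonneg _)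
        (Finset.mem_univ Y)
    have h2 := le_abs_self (f Y - f ∅)
    have h3 := abs_nonneg (f Y - f ∅)
    simp only [Finset.card_empty, Nat.cast_zero, mul_zero]
    nlinarith

theorem essentialValue_strictAnti {N : Type*} [Fintype N] (f : Finset N → ℤ) :
    StrictAnti (essentialValue f) := fun _ _ h =>
  ((essentialValues f).orderEmbOfFin rfl).strictMono (Fin.rev_lt_rev.2 h)

theorem exists_essentialValue_eq {N : Type*} [Fintype N] {f : Finset N → ℤ} {β : ℤ}
    (hβ : IsEssential f β) : ∃ j, essentialValue f j = β := by
  have : β ∈ Set.range ((essentialValues f).orderEmbOfFin rfl) := by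
    rw [Finset.range_orderEmbOfFin]
    simpa [essentialValues] using hβ
  obtain ⟨j, hj⟩ := this
  refine ⟨Fin.rev j, ?_⟩
  change (essentialValues f).orderEmbOfFin rfl (Fin.rev (Fin.rev j)) = β
  rw [Fin.rev_rev, hj]

theorem mem_canonicalClass {N : Type*} [Fintype N] {f : Finset N → ℤ} {j : Fin (numClasses f)}
    {i : N} : i ∈ canonicalClass f j ↔ i ∈ smallestMaximizer f (essentialValue f j - 1) ∧
      i ∉ smallestMaximizer f (essentialValue f j) := by
  simp [canonicalClass]

theorem mem_smallestMaximizer_iff {N : Type*} [Fintype N] [DecidableEq N] {f : Finset N → ℤ}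
    (hf : IsSupermodular f) {γ : ℤ} {i : N} :
    i ∈ smallestMaximizer f γ ↔ ∃ j, i ∈ canonicalClass f j ∧ γ < essentialValue f j := by
  constructor
  · intro hi
    obtain ⟨B, hB⟩ := exists_smallestMaximizer_eq_empty f
    -- At the last level b with i ∈ L(b), the value b + 1 is essential, and its class contains i.
    obtain ⟨b, hb, hmax⟩ := Int.exists_greatest_of_bdd
      (P := fun β => i ∈ smallestMaximizer f β)
      ⟨B, fun β hβ => by
        by_contra! h
        rw [hB β h.le] at hβ
        exact absurd hβ (Finset.notMem_empty i)⟩ ⟨γ, hi⟩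
    have hb1 : i ∉ smallestMaximizer f (b + 1) := fun h => by have := hmax _ h; omega
    obtain ⟨j, hj⟩ : ∃ j, essentialValue f j = b + 1 := by
      refine exists_essentialValue_eq fun h => hb1 ?_
      rw [h, add_sub_cancel_right]
      exact hb
    refine ⟨j, ?_, ?_⟩
    · rw [mem_canonicalClass, hj, add_sub_cancel_right]
      exact ⟨hb, hb1⟩
    · rw [hj]
      have := hmax _ hi
      omega
  · rintro ⟨j, hj, hγ⟩
    rw [mem_canonicalClass] at hj
    exact smallestMaximizer_anti hf (by omega) hj.1

theorem mem_smallestMaximizer_essentialValue_sub_one_iff {N : Type*} [Fintype N] [DecidableEq N]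
    {f : Finset N → ℤ} (hf : IsSupermodular f) {j : Fin (numClasses f)} {i : N} :
    i ∈ smallestMaximizer f (essentialValue f j - 1) ↔ ∃ j' ≤ j, i ∈ canonicalClass f j' := by
  rw [mem_smallestMaximizer_iff hf]
  refine exists_congr fun j' => ?_
  rw [Int.sub_one_lt_iff, (essentialValue_strictAnti f).le_iff_ge, and_comm]

theorem mem_smallestMaximizer_essentialValue_iff {N : Type*} [Fintype N] [DecidableEq N]
    {f : Finset N → ℤ} (hf : IsSupermodular f) {j : Fin (numClasses f)} {i : N} :
    i ∈ smallestMaximizer f (essentialValue f j) ↔ ∃ j' < j, i ∈ canonicalClass f j' := by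
  rw [mem_smallestMaximizer_iff hf]
  refine exists_congr fun j' => ?_
  rw [(essentialValue_strictAnti f).lt_iff_gt, and_comm]

/-- A good of the class induced by `P_j` is not forced into `P_1 ∪ ⋯ ∪ P_{j-1}`. -/
theorem exists_ne_zero_of_mem_inducedClass {N G : Type*} {q : ℕ} {P : Fin q → Finset N}
    {w : N → G → ℕ} (hw : ∀ g, ∃ i, w i g ≠ 0) {j : Fin q} {g : G} (hg : g ∈ inducedClass P w j) :
    ∃ i, (∀ j' < j, i ∉ P j') ∧ w i g ≠ 0 := by
  rw [inducedClass] at hg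
  by_contra! h
  by_cases hj : j.val = 0
  · obtain ⟨i, hi⟩ := hw g
    exact hi (h i fun j' hj' => absurd (Fin.lt_def.1 hj') (by omega))
  have hex : ∃ j' < j, ∀ i, (∀ j'' ≤ j', i ∉ P j'') → w i g = 0 := by
    refine ⟨⟨j.val - 1, by omega⟩, Fin.lt_def.2 (by simp; omega), fun i hi => h i fun j'' hj'' => ?_⟩
    exact hi j'' (Fin.le_def.2 (by have := Fin.lt_def.1 hj''; simp; omega))
  -- The good belongs to the class of the first index at which it is forced, which would come before
  -- j.
  obtain ⟨j', ⟨hj'j, hj'⟩, hmin⟩ := WellFounded.has_min (wellFounded_lt (α := Fin q))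
    {j' | j' < j ∧ ∀ i, (∀ j'' ≤ j', i ∉ P j'') → w i g = 0} hex
  refine hg.1 j' hj'j ?_
  rw [inducedClass]
  refine ⟨fun k hk hgk => hmin k ⟨hk.trans hj'j, ?_⟩ hk, hj'⟩
  rw [inducedClass] at hgk
  exact hgk.2

/-- If `P_1, …, P_q` is the canonical partition of `f`, and all the agents of `L(β)` only receive
goods forced into `L(β)`, then the goods of the `j`-th induced class go to `P_j`. -/
theorem sum_canonicalClass_eq_one {N G : Type*} [Fintype N] [DecidableEq N] {f : Finset N → ℤ}
    (hf : IsSupermodular f) {w : N → G → ℕ} (hw : ∀ g, ∃ i, w i g ≠ 0) {y : N → G → ℝ}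
    (hcol : ∀ g, ∑ i, y i g = 1) (hyw : ∀ i g, w i g = 0 → y i g = 0)
    (htight : ∀ β, ∀ i ∈ smallestMaximizer f β, ∀ k ∉ smallestMaximizer f β, ∀ g,
      w k g ≠ 0 → y i g = 0) {j : Fin (numClasses f)} {g : G}
    (hg : g ∈ inducedClass (canonicalClass f) w j) :
    ∑ i ∈ canonicalClass f j, y i g = 1 := by
  rw [← hcol g]
  refine Finset.sum_subset (Finset.subset_univ _) fun i _ hi => ?_
  rw [mem_canonicalClass, not_and_or, not_not] at hi
  rcases hi with hi | hi
  · rw [inducedClass] at hg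
    refine hyw i g (hg.2 i fun j' hj' hij' => hi ?_)
    exact (mem_smallestMaximizer_essentialValue_sub_one_iff hf).2 ⟨j', hj', hij'⟩
  · obtain ⟨k, hk, hkg⟩ := exists_ne_zero_of_mem_inducedClass hw hg
    refine htight _ i hi k (fun h => ?_) g hkg
    obtain ⟨j', hj', hkj'⟩ := (mem_smallestMaximizer_essentialValue_iff hf).1 h
    exact hk j' hj' hkj'

/-! ### Improving exchanges and tight sets in a minimizer. -/

namespace FairInstance

theorem isAllocation_of_nonneg {N M C : Type*} [Fintype N] {I : FairInstance N M C}
    {π : N → M ⊕ C → ℝ} (h0 : ∀ i e, 0 ≤ π i e) (h1 : ∀ e, ∑ i, π i e = 1)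
    (hv : ∀ i e, I.v i e = 0 → π i e = 0)
    (hint : ∀ i (g : M), π i (Sum.inl g) = 0 ∨ π i (Sum.inl g) = 1) : I.IsAllocation π :=
  ⟨fun i e => ⟨h0 i e, h1 e ▸
    Finset.single_le_sum (f := fun i => π i e) (fun i _ => h0 i e) (Finset.mem_univ i)⟩,
    h1, hv, hint⟩

/-- The divisible goods held by agents whose utility is not `β`. -/
def movableGoods {N M C : Type*} [Fintype M] [Fintype C] (π : N → M ⊕ C → ℝ)
    (β : ℤ) : Set (M ⊕ C) :=
  {e | ∃ c, e = Sum.inr c ∧ ∃ i, 0 < π i (Sum.inr c) ∧ utility π i ≠ β}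

open Classical in
theorem sum_eq_sum_compl_movableGoods_add {N M C : Type*} [Fintype M] [Fintype C]
    (π : N → M ⊕ C → ℝ) (β : ℤ) (F : M ⊕ C → ℝ) :
    ∑ e, F e = ∑ e : {e // e ∉ movableGoods π β}, F e +
      ∑ c, if Sum.inr c ∈ movableGoods π β then F (Sum.inr c) else 0 := by
  have hinl : ∀ g : M, Sum.inl g ∉ movableGoods π β := by
    rintro g ⟨c, hc, -⟩
    exact absurd hc (by simp)
  have h1 : ∑ e : {e // e ∉ movableGoods π β}, F e =
      ∑ e ∈ Finset.univ.filter (fun e => e ∉ movableGoods π β), F e :=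
    (Finset.sum_subtype _ (by simp) F).symm
  rw [h1, Finset.sum_filter]
  simp only [Fintype.sum_sum_type, hinl, not_false_eq_true, if_true]
  rw [add_assoc, ← Finset.sum_add_distrib]
  congr 1
  refine Finset.sum_congr rfl fun c _ => ?_
  by_cases hc : Sum.inr c ∈ movableGoods π β <;> simp [hc]

variable {N M C : Type*} [Fintype N] [Fintype M] [Fintype C] {I : FairInstance N M C}
  {π : N → M ⊕ C → ℝ} {Φ : (N → ℝ) → ℝ}

theorem IsAllocation.sum_utility (hπ : I.IsAllocation π) :
    ∑ i, utility π i = Fintype.card (M ⊕ C) := by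
  simp only [utility]
  rw [Finset.sum_comm]
  simp [hπ.sum_eq_one]

/-- In a minimizer, an agent holding a share of a divisible good is not better off than any other
agent who values it. -/
theorem utility_le_of_divisible (hsymm : IsSymmetric Φ) (hconv : StrictConvexOn ℝ Set.univ Φ)
    (hπ : I.IsAllocation π) (hmin : IsPhiMinimizer Φ I.utilitySet (utility π)) {i k : N} {c : C}
    (hi : 0 < π i (Sum.inr c)) (hk : I.v k (Sum.inr c) ≠ 0) : utility π i ≤ utility π k := by
  classical
  by_contra! hlt
  have hik : i ≠ k := by rintro rfl; exact lt_irrefl _ hlt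
  set δ := min (π i (Sum.inr c)) ((utility π i - utility π k) / 2) with hδ
  have hδ0 : 0 < δ := lt_min hi (by linarith)
  have hδ1 : δ ≤ π i (Sum.inr c) := min_le_left _ _
  have hδ2 : δ ≤ (utility π i - utility π k) / 2 := min_le_right _ _
  set π' : N → M ⊕ C → ℝ := fun a e => π a e + if e = Sum.inr c then
    ((if a = k then δ else 0) - (if a = i then δ else 0)) else 0 with hπ'
  have hall : I.IsAllocation π' := by
    refine isAllocation_of_nonneg (fun a e => ?_) (fun e => ?_) (fun a e h => ?_) (fun a g => ?_)
    · have h0 := (hπ.mem_Icc a e).1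
      by_cases he : e = Sum.inr c
      · subst he
        by_cases hai : a = i
        · subst hai
          simp only [hπ', if_true, if_neg hik]
          linarith
        · by_cases hak : a = k
          · simp only [hπ', hak, if_true]
            rw [hak] at h0
            split_ifs <;> linarith
          · simpa [hπ', hai, hak] using h0
      · simpa [hπ', he] using h0
    · by_cases he : e = Sum.inr c
      · simp [hπ', he, Finset.sum_add_distrib, hπ.sum_eq_one]
      · simp [hπ', he, hπ.sum_eq_one]
    · by_cases he : e = Sum.inr c
      · subst he
        have hak : a ≠ k := by rintro rfl; exact hk h
        have hai : a ≠ i := by rintro rfl; exact hi.ne' (hπ.eq_zero _ _ h)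
        simp [hπ', hak, hai, hπ.eq_zero _ _ h]
      · simp [hπ', he, hπ.eq_zero _ _ h]
    · simpa [hπ'] using hπ.integral a g
  have hu : ∀ a, utility π' a =
      utility π a + ((if a = k then δ else 0) - (if a = i then δ else 0)) := by
    intro a
    simp only [utility, hπ', Finset.sum_add_distrib, Finset.sum_ite_eq', Finset.mem_univ, if_true]
  refine absurd (hmin.2 _ hall.utility_mem) (not_le.2 ?_)
  refine lt_of_transfer hsymm hconv (s := k) (t := i) hδ0 (by linarith) ?_ ?_ ?_
  · rw [hu]; simp [hik.symm]
  · rw [hu]; simp [hik, sub_eq_add_neg]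
  · intro a hak hai; rw [hu]; simp [hak, hai]

open Classical in
/-- In a minimizer, goods that are not movable cannot be passed on from an agent with utility above
`β` to an agent with utility below `β`. -/
theorem le_utility_of_reachable (hsymm : IsSymmetric Φ) (hconv : StrictConvexOn ℝ Set.univ Φ)
    (hπ : I.IsAllocation π) (hmin : IsPhiMinimizer Φ I.utilitySet (utility π)) {β : ℤ} {s t : N}
    (ht : β < utility π t) (hreach : Relation.ReflTransGen
      (fun i k => ∃ e ∉ movableGoods π β, 0 < π i e ∧ I.v k e ≠ 0) t s) :
    β ≤ utility π s := by
  by_contra! hs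
  set D := movableGoods π β with hD
  have hst : s ≠ t := by rintro rfl; linarith
  have hπ0 : ∀ i e, 0 ≤ π i e := fun i e => (hπ.mem_Icc i e).1
  have hVpos : ∀ i e, 0 < π i e → I.v i e ≠ 0 := fun i e h hv => h.ne' (hπ.eq_zero i e hv)
  have hshare : ∀ i k c, 0 < π i (Sum.inr c) → 0 < π k (Sum.inr c) →
      utility π i = utility π k := fun i k c hi hk =>
    le_antisymm (utility_le_of_divisible hsymm hconv hπ hmin hi (hVpos k _ hk))
      (utility_le_of_divisible hsymm hconv hπ hmin hk (hVpos i _ hi))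
  set Y : N → C → ℝ := fun i c => if Sum.inr c ∈ D then π i (Sum.inr c) else 0 with hY
  have hY0 : ∀ i c, 0 ≤ Y i c := fun i c => by
    simp only [hY]; split_ifs
    · exact hπ0 i _
    · exact le_rfl
  have hYpos : ∀ i c, 0 < Y i c → Sum.inr c ∈ D ∧ 0 < π i (Sum.inr c) := by
    intro i c h
    by_cases hc : Sum.inr c ∈ D
    · exact ⟨hc, by simpa [hY, hc] using h⟩
    · simp [hY, hc] at h
  have hYne : ∀ i c, 0 < Y i c → utility π i ≠ β := by
    intro i c h
    obtain ⟨⟨c', hc', k, hk, hkβ⟩, hi⟩ := hYpos i c h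
    obtain rfl := Sum.inr_injective hc'
    rwa [hshare i k c hi hk]
  -- An agent of utility β holds no movable good, so the sum is β; any other agent holds only whole
  -- indivisible goods outside D.
  have hrow : ∀ i, ∃ n : ℕ, ∑ e : {e // e ∉ D}, π i e = n := by
    intro i
    by_cases hi : utility π i = β
    · have h0 : ∑ c, Y i c = 0 := Finset.sum_eq_zero fun c _ =>
        le_antisymm (not_lt.1 fun h => hYne i c h hi) (hY0 i c)
      have h1 := sum_eq_sum_compl_movableGoods_add π β (π i)
      rw [← hD] at h1
      have hβ : 0 ≤ β := by
        have : (0 : ℝ) ≤ β := hi ▸ Finset.sum_nonneg fun e _ => hπ0 i e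
        exact_mod_cast this
      lift β to ℕ using hβ
      refine ⟨β, ?_⟩
      simp only [utility] at hi
      simp only [hY] at h0
      rw [h1, h0, add_zero] at hi
      exact_mod_cast hi
    · refine ⟨∑ e : {e // e ∉ D}, if π i e = 1 then 1 else 0, ?_⟩
      rw [Nat.cast_sum]
      refine Finset.sum_congr rfl fun e _ => ?_
      obtain ⟨e | c, he⟩ := e
      · rcases hπ.integral i e with h | h <;> simp [h]
      · have : π i (Sum.inr c) = 0 :=
          le_antisymm (not_lt.1 fun h => he ⟨c, rfl, i, h, hi⟩) (hπ0 i _)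
        simp [this]
  choose r hr using hrow
  have hYrow : ∀ i, ∑ c, Y i c = utility π i - r i := by
    intro i
    have h1 := sum_eq_sum_compl_movableGoods_add π β (π i)
    rw [← hD, hr] at h1
    rw [utility, h1]
    simp [hY]
  obtain ⟨h, hhV, hhrow⟩ := exists_assignment_of_reachable
    (fun i (g : {e // e ∉ D}) => I.v i g ≠ 0) (y := fun i g => π i g) (fun i g => hπ0 i g)
    (fun g => hπ.sum_eq_one g) (fun i g => hVpos i g) hr hst
    (Relation.ReflTransGen.mono (fun i k ⟨e, he, hie, hke⟩ => ⟨⟨e, he⟩, hie, hke⟩) _ _ hreach)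
  -- Among the agents above β: the bound `β - r i` keeps the others at utility at least β, and the
  -- target `β + 1 - r t` brings t back to at least β after the loss of a unit.
  obtain ⟨Y₁, hY₁0, hY₁col, hY₁Y, hY₁out, hY₁in, hY₁t, hY₁t'⟩ := exists_shift_row hY0
    (fun c => if Sum.inr c ∈ D then 1 else 0)
    (fun c => by by_cases hc : Sum.inr c ∈ D <;> simp [hY, hc, hπ.sum_eq_one])
    {i | (β : ℝ) < utility π i}
    (fun i k c hi hk h => by
      have := hshare i k c (hYpos i c hi).2 (hYpos k c hk).2
      simpa only [Set.mem_ofPred_eq, this] using h)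
    ht (fun i => β - r i) (σ := 1) (by norm_num)
    (fun i hi => by
      have hi : (β : ℝ) < utility π i := hi
      rw [hYrow]; push_cast; linarith)
    (β + 1 - r t) (by rw [hYrow]; push_cast; linarith)
  have hY₁s : ∀ i, utility π i ≤ β → ∑ c, Y₁ i c = utility π i - r i := fun i hi => by
    rw [hY₁out i (not_lt.2 hi), hYrow]
  -- The mirror image below β: s gives away its excess after gaining a unit, and the others rise at
  -- most to β. The first shift only shrank the support and left these rows alone.
  obtain ⟨Y₂, hY₂0, hY₂col, hY₂Y₁, hY₂out, hY₂in, hY₂s, hY₂s'⟩ := exists_shift_row hY₁0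
    (fun c => if Sum.inr c ∈ D then 1 else 0) hY₁col
    {i | utility π i < (β : ℝ)}
    (fun i k c hi hk h => by
      have := hshare i k c (hYpos i c (hY₁Y _ _ hi)).2 (hYpos k c (hY₁Y _ _ hk)).2
      simpa only [Set.mem_ofPred_eq, this] using h)
    hs (fun i => r i - β) (σ := -1) (by norm_num)
    (fun i hi => by
      have hi : utility π i < (β : ℝ) := hi
      rw [hY₁s i hi.le]; push_cast; linarith)
    (r s - β + 1) (by rw [hY₁s s hs.le]; push_cast; linarith)
  have hY₂pos : ∀ i c, 0 < Y₂ i c → Sum.inr c ∈ D ∧ 0 < π i (Sum.inr c) := fun i c h =>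
    hYpos i c (hY₁Y i c (hY₂Y₁ i c h))
  set π' : N → M ⊕ C → ℝ := fun i e => if he : e ∈ D then Sum.elim (fun _ => 0) (Y₂ i) e else
    if h ⟨e, he⟩ = i then 1 else 0 with hπ'
  have hinl : ∀ g : M, Sum.inl g ∉ D := by
    rintro g ⟨c, hc, -⟩
    exact absurd hc (by simp)
  have hall : I.IsAllocation π' := by
    refine isAllocation_of_nonneg (fun i e => ?_) (fun e => ?_) (fun i e hv => ?_) (fun i g => ?_)
    · simp only [hπ']
      split_ifs
      · rcases e with g | c
        · exact le_rfl
        · exact hY₂0 i c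
      · exact zero_le_one
      · exact le_rfl
    · by_cases he : e ∈ D
      · rcases e with g | c
        · exact absurd he (hinl g)
        · simp [hπ', he, hY₂col]
      · simp [hπ', he]
    · by_cases he : e ∈ D
      · rcases e with g | c
        · exact absurd he (hinl g)
        · have : Y₂ i c = 0 := le_antisymm
            (not_lt.1 fun h => hVpos i _ (hY₂pos i c h).2 hv) (hY₂0 i c)
          simp [hπ', he, this]
      · have : h ⟨e, he⟩ ≠ i := by
          intro hi
          exact hhV ⟨e, he⟩ (by rw [hi]; exact hv)
        simp [hπ', he, this]
    · simp only [hπ', hinl g, dif_neg, not_false_eq_true]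
      split_ifs <;> simp
  have hu : ∀ i, utility π' i =
      r i - (if i = t then 1 else 0) + (if i = s then 1 else 0) + ∑ c, Y₂ i c := by
    intro i
    rw [utility, sum_eq_sum_compl_movableGoods_add π β, ← hD, ← hhrow i]
    congr 1
    · refine Finset.sum_congr rfl fun e _ => ?_
      simp [hπ', e.2]
    · refine Finset.sum_congr rfl fun c _ => ?_
      by_cases hc : Sum.inr c ∈ D
      · simp [hπ', hc]
      · rw [if_neg hc]
        exact (le_antisymm (not_lt.1 fun h => hc (hY₂pos i c h).1) (hY₂0 i c)).symm
  have hut : β ≤ utility π' t ∧ utility π' t < utility π t := by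
    rw [hu, if_pos rfl, if_neg hst.symm, hY₂out t (not_lt.2 ht.le)]
    rw [hYrow] at hY₁t'
    push_cast at hY₁t hY₁t'
    refine ⟨by linarith, ?_⟩
    rcases max_cases ((β : ℝ) + 1 - r t) (1 * (utility π t - r t)) with hm | hm <;>
      rw [hm.1] at hY₁t' <;> linarith
  have hus : utility π s ≤ utility π' s ∧ utility π' s ≤ β := by
    rw [hu, if_neg hst, if_pos rfl]
    rw [hY₁s s hs.le] at hY₂s'
    push_cast at hY₂s hY₂s'
    refine ⟨?_, by linarith⟩
    rcases max_cases ((r s : ℝ) - β + 1) (-1 * (utility π s - r s)) with hm | hm <;>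
      rw [hm.1] at hY₂s' <;> linarith
  refine absurd (hmin.2 _ hall.utility_mem) (not_le.2 ?_)
  refine lt_of_pull hsymm hconv β (fun i => ?_) (by rw [hall.sum_utility, hπ.sum_utility])
    (fun heq => hut.2.ne (congrFun heq t))
  by_cases hit : i = t
  · subst hit; exact Or.inl ⟨hut.1, hut.2.le⟩
  by_cases his : i = s
  · subst his; exact Or.inr hus
  rw [hu, if_neg hit, if_neg his]
  rcases lt_trichotomy (utility π i) β with hi | hi | hi
  · have h2 := hY₂in i hi his
    rw [hY₁s i hi.le] at h2
    push_cast at h2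
    right; constructor <;> linarith
  · rw [hY₂out i (not_lt.2 hi.ge), hY₁s i hi.le]
    right; constructor <;> linarith
  · have h1 := hY₁in i hi hit
    rw [hYrow] at h1
    push_cast at h1
    rw [hY₂out i (not_lt.2 hi.le)]
    left; constructor <;> linarith

/-- A minimizer has a set of agents separating the utilities above `β` from those below `β`, whose
members only hold goods without value for the other agents. -/
theorem exists_separating_finset (hsymm : IsSymmetric Φ) (hconv : StrictConvexOn ℝ Set.univ Φ)
    (hπ : I.IsAllocation π) (hmin : IsPhiMinimizer Φ I.utilitySet (utility π)) (β : ℤ) :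
    ∃ R : Finset N, (∀ i, β < utility π i → i ∈ R) ∧ (∀ i ∈ R, β ≤ utility π i) ∧
      ∀ i ∈ R, ∀ k ∉ R, ∀ e, I.v k e ≠ 0 → π i e = 0 := by
  classical
  refine ⟨Finset.univ.filter fun k => ∃ t, β < utility π t ∧ Relation.ReflTransGen
      (fun i k => ∃ e ∉ movableGoods π β, 0 < π i e ∧ I.v k e ≠ 0) t k, ?_, ?_, ?_⟩
  · intro i hi
    exact Finset.mem_filter.2 ⟨Finset.mem_univ _, i, hi, .refl⟩
  · intro i hi
    obtain ⟨-, t, ht, hti⟩ := Finset.mem_filter.1 hi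
    exact le_utility_of_reachable hsymm hconv hπ hmin ht hti
  · intro i hi k hk e hv
    obtain ⟨-, t, ht, hti⟩ := Finset.mem_filter.1 hi
    refine le_antisymm (not_lt.1 fun hie => hk ?_) (hπ.mem_Icc i e).1
    refine Finset.mem_filter.2 ⟨Finset.mem_univ _, ?_⟩
    -- The holder i of a movable good has utility at least β but not β, so k, valuing the good, is
    -- itself above β and starts a path.
    by_cases he : e ∈ movableGoods π β
    · obtain ⟨c, rfl, a, ha, haβ⟩ := he
      have h1 : utility π a = utility π i := le_antisymm
        (utility_le_of_divisible hsymm hconv hπ hmin ha fun h => hie.ne' (hπ.eq_zero _ _ h))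
        (utility_le_of_divisible hsymm hconv hπ hmin hie fun h => ha.ne' (hπ.eq_zero _ _ h))
      have h2 := le_utility_of_reachable hsymm hconv hπ hmin ht hti
      have h3 := utility_le_of_divisible hsymm hconv hπ hmin hie hv
      exact ⟨k, (lt_of_le_of_ne h2 fun h => haβ (h1.trans h.symm)).trans_le h3, .refl⟩
    · exact ⟨t, ht, hti.tail ⟨e, he, hie, hv⟩⟩

-- The excess of u(X) over f_E(X) is what X holds of goods that some outsider values, so u(X) =
-- f_E(X) means that X holds nothing of them.
open Classical in
theorem IsAllocation.sum_utility_eq_fE_add (hπ : I.IsAllocation π) (X : Finset N) :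
    ∑ i ∈ X, utility π i = I.fE X +
      ∑ e ∈ Finset.univ.filter (fun e => ¬ ∀ i, i ∉ X → I.v i e = 0), ∑ i ∈ X, π i e := by
  have h1 := sum_rows_eq_forcedCount_add (fun g : M => hπ.sum_eq_one (Sum.inl g))
    (fun i g => hπ.eq_zero i _) X
  have h2 := sum_rows_eq_forcedCount_add (fun c : C => hπ.sum_eq_one (Sum.inr c))
    (fun i c => hπ.eq_zero i _) X
  simp only [utility, Fintype.sum_sum_type, Finset.sum_add_distrib, fE, fM, fC, Int.cast_add]
  rw [h1, h2]
  simp only [Finset.sum_filter, Fintype.sum_sum_type]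
  ring

/-- In a minimizer, the agents in `L(β)` only hold goods without value for the other agents. -/
theorem eq_zero_of_mem_smallestMaximizer (hsymm : IsSymmetric Φ)
    (hconv : StrictConvexOn ℝ Set.univ Φ) (hπ : I.IsAllocation π)
    (hmin : IsPhiMinimizer Φ I.utilitySet (utility π)) (β : ℤ) :
    ∀ i ∈ smallestMaximizer I.fE β, ∀ k ∉ smallestMaximizer I.fE β, ∀ e,
      I.v k e ≠ 0 → π i e = 0 := by
  classical
  obtain ⟨R, hRgt, hRge, hR⟩ := exists_separating_finset hsymm hconv hπ hmin β
  obtain ⟨hL, -⟩ := isLeast_smallestMaximizer I.isSupermodular_fE β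
  set L := smallestMaximizer I.fE β
  have hRf : ∑ i ∈ R, utility π i = I.fE R := by
    rw [hπ.sum_utility_eq_fE_add, add_eq_left]
    refine Finset.sum_eq_zero fun e he => Finset.sum_eq_zero fun i hi => ?_
    have he := (Finset.mem_filter.1 he).2
    push Not at he
    obtain ⟨k, hk, hke⟩ := he
    exact hR i hi k hk e hke
  -- R omits no positive term u_i - β and contains no negative one.
  have hLR : ∑ i ∈ L, (utility π i - β) ≤ ∑ i ∈ R, (utility π i - β) := by
    rw [← Finset.sum_sdiff_le_sum_sdiff]
    refine le_trans (b := 0) (Finset.sum_nonpos fun i hi => ?_) (Finset.sum_nonneg fun i hi => ?_)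
    · exact sub_nonpos.2 (not_lt.1 fun h => (Finset.mem_sdiff.1 hi).2 (hRgt i h))
    · exact sub_nonneg.2 (hRge i (Finset.mem_sdiff.1 hi).1)
  have hmax : (I.fE R : ℝ) - β * R.card ≤ I.fE L - β * L.card := by exact_mod_cast hL R
  simp only [Finset.sum_sub_distrib, Finset.sum_const, nsmul_eq_mul, hRf] at hLR
  have hsplit := hπ.sum_utility_eq_fE_add L
  have hnn : ∀ e, 0 ≤ ∑ i ∈ L, π i e := fun e => Finset.sum_nonneg fun i _ => (hπ.mem_Icc i e).1
  have hzero : ∑ e ∈ Finset.univ.filter (fun e => ¬ ∀ i, i ∉ L → I.v i e = 0),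
      ∑ i ∈ L, π i e = 0 :=
    le_antisymm (by linarith) (Finset.sum_nonneg fun e _ => hnn e)
  intro i hi k hk e hke
  have h1 := (Finset.sum_eq_zero_iff_of_nonneg fun e _ => hnn e).1 hzero e
    (Finset.mem_filter.2 ⟨Finset.mem_univ _, fun h => hke (h k hk)⟩)
  exact (Finset.sum_eq_zero_iff_of_nonneg fun i _ => (hπ.mem_Icc i e).1).1 h1 i hi

end FairInstance

end MixedFair

theorem theorem4p10 {N M C : Type*} [Fintype N] [Fintype M] [Fintype C]
    (I : MixedFair.FairInstance N M C)
    (Φ : (N → ℝ) → ℝ) (hsymm : MixedFair.IsSymmetric Φ)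
    (hconv : StrictConvexOn ℝ Set.univ Φ)
    (π : N → M ⊕ C → ℝ) (hπ : I.IsAllocation π)
    (hmin : MixedFair.IsPhiMinimizer Φ I.utilitySet (MixedFair.utility π))
    (j : Fin I.numClasses) :
    (∀ g ∈ I.indivisibleClass j, ∑ i ∈ I.agentClass j, π i (Sum.inl g) = 1) ∧
      (∀ c ∈ I.divisibleClass j, ∑ i ∈ I.agentClass j, π i (Sum.inr c) = 1) := by
  classical
  have hdes : ∀ e, ∃ i, I.v i e ≠ 0 := fun e =>
    (I.desired e).imp fun i hi => by rw [hi]; exact one_ne_zero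
  have htight := MixedFair.FairInstance.eq_zero_of_mem_smallestMaximizer hsymm hconv hπ hmin
  exact ⟨fun g hg => MixedFair.sum_canonicalClass_eq_one I.isSupermodular_fE
      (fun g => hdes (Sum.inl g)) (y := fun i g => π i (Sum.inl g)) (fun g => hπ.sum_eq_one _)
      (fun i g => hπ.eq_zero i _) (fun β i hi k hk g => htight β i hi k hk _) hg,
    fun c hc => MixedFair.sum_canonicalClass_eq_one I.isSupermodular_fE
      (fun c => hdes (Sum.inr c)) (y := fun i c => π i (Sum.inr c)) (fun c => hπ.sum_eq_one _)
      (fun i c => hπ.eq_zero i _) (fun β i hi k hk c => htight β i hi k hk _) hc⟩
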